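/- Let $k$ be a field of characteristic $0$, let $\overline{k}$ be its algebraic closure, and let $\mathbb{A}^n=\overline{k}^{\,n}$. For an irreducible closed subvariety $V\subset\mathbb{A}^n$, let $\deg V$ be the supremum of $|V\cap E|$ over all affine linear subspaces $E\subset\mathbb{A}^n$ of dimension $n-\dim V$ such that $V\cap E$ is finite; for an arbitrary closed subvariety $X$, let $\deg X$ be the sum of the degrees of its irreducible components. Let $q,r\geqslant 0$, let $X\subset\mathbb{A}^q\times\mathbb{A}^r$ be an affine variety (the set of common zeros in $\overline{k}^{\,q+r}$ of a set of polynomials with coefficients in $k$, not necessarily irreducible), let $\pi\colon\mathbb{A}^q\times\mathbb{A}^r\to\mathbb{A}^r$ be the projection, and let $S\subset k$ be a finite nonempty set. Then the number of points $a=(a_1,\ldots,a_r)\in S^r\subset\mathbb{A}^r$ such that \[ \overline{\pi(X)}=\mathbb{A}^r\iff X\cap\pi^{-1}(a)\neq\varnothing \] (Zariski closure) is at least \[ \left(1-\frac{\deg X}{|S|}\right)\cdot|S|^r . \] The same holds with $\overline{k}$ replaced by any algebraically closed field extension of $k$. -/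

import Mathlib

open scoped ENNReal

/-! Classical affine varieties over an algebraically closed field `K`, as sets of points of
the affine space `σ → K`. -/

namespace AffVar

variable {σ K : Type*} [Field K]

/-- A Zariski closed subset of the affine space `σ → K`: the common zeros of a set of polynomials
with coefficients in `K`. -/
def IsZariskiClosed (V : Set (σ → K)) : Prop :=
  ∃ I : Ideal (MvPolynomial σ K), V = MvPolynomial.zeroLocus K I

/-- Zariski density: the only closed set containing `A` is the whole space. -/
def IsZariskiDense (A : Set (σ → K)) : Prop :=
  ∀ W : Set (σ → K), IsZariskiClosed W → A ⊆ W → W = Set.univ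

/-- An irreducible closed subset: nonempty, and not the union of two proper closed subsets. -/
def IsIrreducibleClosed (V : Set (σ → K)) : Prop :=
  IsZariskiClosed V ∧ V.Nonempty ∧
    ∀ A B : Set (σ → K), IsZariskiClosed A → IsZariskiClosed B → V ⊆ A ∪ B → V ⊆ A ∨ V ⊆ B

/-- The irreducible components of `X`: its maximal irreducible closed subsets. -/
def components (X : Set (σ → K)) : Set (Set (σ → K)) :=
  {Z | Maximal (fun V => IsIrreducibleClosed V ∧ V ⊆ X) Z}

/-- The dimension of an irreducible closed set: the transcendence degree over `K` of its
coordinate ring (equivalently, of its function field). -/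
noncomputable def dim (V : Set (σ → K)) : ℕ :=
  Cardinal.toNat (Algebra.trdeg K (MvPolynomial σ K ⧸ MvPolynomial.vanishingIdeal K V))

/-- The degree of an irreducible closed set `V` in an affine space of dimension `n`: the supremum of
the number of points of `V ∩ E` over all affine linear subspaces `E` of dimension `n - dim V` such
that `V ∩ E` is finite. The supremum is taken in `ℕ ∪ {∞}`; by the Bézout inequality it is
finite. -/
noncomputable def irredDegree [Fintype σ] (V : Set (σ → K)) : ℕ∞ :=
  ⨆ (E : AffineSubspace K (σ → K)) (_ : (E : Set (σ → K)).Nonempty)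
    (_ : Module.finrank K E.direction + dim V = Fintype.card σ)
    (_ : (V ∩ (E : Set (σ → K))).Finite), (V ∩ (E : Set (σ → K))).encard

/-- The degree of a closed set: the sum of the degrees of its (finitely many) irreducible
components, of whatever dimensions. -/
noncomputable def degree [Fintype σ] (X : Set (σ → K)) : ℕ∞ :=
  ∑ᶠ Z ∈ components X, irredDegree Z

/-- The projection `𝔸^q × 𝔸^r → 𝔸^r`, a point of the product being given by the family of its
`q + r` coordinates. -/
def proj {q r : ℕ} (x : Fin q ⊕ Fin r → K) : Fin r → K :=
  fun j => x (Sum.inr j)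

end AffVar

/-! Everything rests on a degree bound for an irreducible `V` (`totalDegree_le_irredDegree`): if
linear forms `W i` give a transcendence basis of the coordinate ring and an irreducible `F`
satisfies `F(u, W) = 0` for a further linear form `u`, then `F` has total degree at most `deg V`. A
shear `w i = W i - α i • u` makes `F` monic in `u` up to a unit, of degree `totalDegree F`. In
characteristic 0 a general fibre of `w` is finite and `u` takes `totalDegree F` distinct values on
it, and this fibre is the intersection of `V` with an affine subspace of complementary dimension.

Call `a` bad if the equivalence fails at `a`. If the projection of `V` is not dense, the last `r`
coordinates are dependent on `V`. An irreducible relation among them has degree at most `deg V` and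
vanishes on the projection, so Schwartz–Zippel bounds the grid points lying there.

If the projection is dense, complete the `r` coordinates by `n` others to a transcendence basis.
Over a point `b` of affine `(r+n)`-space with empty fibre, some coordinate is not integral over the
local ring at `b`, so the linear forms integral there form a proper subspace. A linear form `v`
outside these finitely many subspaces satisfies an irreducible relation whose leading coefficient in
`v` must vanish at every such `b`. Its degree is at most `deg V`, and Schwartz–Zippel on `S^(r+n)`
gives the bound after division by `|S|^n`.

For general `X`, either one dominant component accounts for all bad points, or no component is
dominant and the bounds add up. -/

namespace AffVar

/-! ### Lifting points along an extension that is integral away from `g = 0` -/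

section Lift

variable {K A B : Type*} [Field K] [CommRing A] [CommRing B] [Algebra K A] [Algebra K B]
  [Algebra B A] [IsScalarTower K B A]

theorem exists_isIntegral_pow_smul (g : B) {t : Set A} (ht : Algebra.adjoin K t = ⊤)
    (hg : ∀ x ∈ t, IsIntegral B (g • x)) (a : A) : ∃ N : ℕ, IsIntegral B (g ^ N • a) := by
  have ha : a ∈ Algebra.adjoin K t := ht ▸ Algebra.mem_top
  induction ha using Algebra.adjoin_induction with
  | mem x hx => exact ⟨1, by simpa using hg x hx⟩
  | algebraMap r =>
    refine ⟨0, ?_⟩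
    rw [pow_zero, one_smul, IsScalarTower.algebraMap_apply K B A]
    exact isIntegral_algebraMap
  | add x y _ _ hx hy =>
    obtain ⟨M, hM⟩ := hx
    obtain ⟨N, hN⟩ := hy
    refine ⟨M + N, ?_⟩
    have h := (hM.smul (g ^ N)).add (hN.smul (g ^ M))
    rwa [smul_smul, smul_smul, ← pow_add, ← pow_add, add_comm N M, ← smul_add] at h
  | mul x y _ _ hx hy =>
    obtain ⟨M, hM⟩ := hx
    obtain ⟨N, hN⟩ := hy
    refine ⟨M + N, ?_⟩
    have h := hM.mul hN
    rwa [smul_mul_smul_comm, ← pow_add] at h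

/-- This is lying over for `B_g → A_g` without localizing. If `1` lay in `pA`, clearing denominators
would put some `g ^ N` in the extension of `p` to the integral closure `C`; a prime of `C` over `p`
then forces `g ∈ p`. -/
theorem map_ne_top_of_isIntegral_smul [FaithfulSMul B A] (g : B) {t : Set A}
    (ht : Algebra.adjoin K t = ⊤) (hg : ∀ x ∈ t, IsIntegral B (g • x)) (p : Ideal B) [p.IsPrime]
    (hgp : g ∉ p) : p.map (algebraMap B A) ≠ ⊤ := by
  let C := integralClosure B A
  have key : ∀ a ∈ p.map (algebraMap B A), ∃ N : ℕ, ∃ c ∈ p.map (algebraMap B C),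
      (c : A) = g ^ N • a := by
    intro a ha
    induction ha using Submodule.span_induction with
    | mem x hx =>
      obtain ⟨b, hb, rfl⟩ := hx
      exact ⟨0, algebraMap B C b, Ideal.mem_map_of_mem _ hb, by simp⟩
    | zero => exact ⟨0, 0, Ideal.zero_mem _, by simp⟩
    | add x y _ _ hx hy =>
      obtain ⟨M, c, hc, hM⟩ := hx
      obtain ⟨N, d, hd, hN⟩ := hy
      refine ⟨M + N, g ^ N • c + g ^ M • d, Ideal.add_mem _ ?_ ?_, ?_⟩
      · rw [Algebra.smul_def]; exact Ideal.mul_mem_left _ _ hc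
      · rw [Algebra.smul_def]; exact Ideal.mul_mem_left _ _ hd
      · push_cast
        rw [hM, hN, smul_smul, smul_smul, ← pow_add, ← pow_add, add_comm N M, ← smul_add]
    | smul a x _ hx =>
      obtain ⟨M, c, hc, hM⟩ := hx
      obtain ⟨N, hN⟩ := exists_isIntegral_pow_smul g ht hg a
      refine ⟨N + M, (⟨g ^ N • a, hN⟩ : C) * c, Ideal.mul_mem_left _ _ hc, ?_⟩
      push_cast
      rw [hM, smul_mul_smul_comm, ← pow_add, smul_eq_mul]
  intro htop
  obtain ⟨N, c, hc, hN⟩ := key 1 (htop ▸ Submodule.mem_top)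
  have hker : (⊥ : Ideal C).comap (algebraMap B C) ≤ p := by
    intro x hx
    have hx0 : algebraMap B A x = 0 := by
      have : algebraMap B C x = 0 := hx
      rw [IsScalarTower.algebraMap_apply B C A, this, map_zero]
    rw [(FaithfulSMul.algebraMap_eq_zero_iff B A).1 hx0]
    exact p.zero_mem
  obtain ⟨Q, -, hQ, hQp⟩ := Ideal.exists_ideal_over_prime_of_isIntegral p (⊥ : Ideal C) hker
  have hcQ : c ∈ Q := (Ideal.map_le_iff_le_comap.2 hQp.ge) hc
  have hcg : c = algebraMap B C (g ^ N) := by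
    apply Subtype.ext
    rw [hN, Algebra.smul_def, mul_one]; rfl
  rw [hcg, ← Ideal.mem_comap, hQp] at hcQ
  exact hgp (Ideal.IsPrime.mem_of_pow_mem ‹_› _ hcQ)

theorem exists_algHom_of_isIntegral_smul [IsAlgClosed K] [Algebra.FiniteType K A]
    [FaithfulSMul B A] (g : B) {t : Set A} (ht : Algebra.adjoin K t = ⊤)
    (hg : ∀ x ∈ t, IsIntegral B (g • x)) (ψ : B →ₐ[K] K) (hψ : ψ g ≠ 0) :
    ∃ φ : A →ₐ[K] K, ∀ b, φ (algebraMap B A b) = ψ b := by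
  have hp : (RingHom.ker ψ).IsPrime := RingHom.ker_isPrime ψ
  have hne := map_ne_top_of_isIntegral_smul g ht hg (RingHom.ker ψ) (by simpa using hψ)
  obtain ⟨M, hM, hle⟩ := Ideal.exists_le_maximal _ hne
  let _ : Field (A ⧸ M) := Ideal.Quotient.field M
  have : Module.Finite K (A ⧸ M) := finite_of_finite_type_of_isJacobsonRing K (A ⧸ M)
  have hbij := IsAlgClosed.algebraMap_bijective_of_isIntegral (k := K) (K := A ⧸ M)
  let e : K ≃ₐ[K] A ⧸ M := AlgEquiv.ofBijective (Algebra.ofId K (A ⧸ M)) hbij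
  refine ⟨(e.symm : (A ⧸ M) →ₐ[K] K).comp (Ideal.Quotient.mkₐ K M), fun b => ?_⟩
  have hb : b - algebraMap K B (ψ b) ∈ RingHom.ker ψ := by
    rw [RingHom.mem_ker, map_sub, AlgHom.commutes]; simp
  have hb' := hle (Ideal.mem_map_of_mem (algebraMap B A) hb)
  rw [map_sub, ← IsScalarTower.algebraMap_apply] at hb'
  have := Ideal.Quotient.eq.2 hb'
  simp only [AlgHom.comp_apply, Ideal.Quotient.mkₐ_eq_mk, this]
  change e.symm (algebraMap K (A ⧸ M) (ψ b)) = _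
  rw [AlgEquiv.commutes]; rfl

end Lift

/-! ### Finite fibres and the number of values of an integral element -/

section Fibre

open MvPolynomial

variable {K A ι : Type*} [Field K] [CommRing A] [Algebra K A]
  [Algebra (MvPolynomial ι K) A] [IsScalarTower K (MvPolynomial ι K) A]

theorem algHom_algebraMap_eq_eval (φ : A →ₐ[K] K) (c : ι → K)
    (hφ : ∀ i, φ (algebraMap (MvPolynomial ι K) A (X i)) = c i) (p : MvPolynomial ι K) :
    φ (algebraMap (MvPolynomial ι K) A p) = eval c p := by
  have h : φ.comp (IsScalarTower.toAlgHom K (MvPolynomial ι K) A) = aeval c := by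
    ext i; simpa using hφ i
  have := DFunLike.congr_fun h p
  simpa [aeval_eq_eval] using this

/-- On the fibre over `c`, the value of `g • x` is a root of a monic polynomial depending only on
`x` and `c`, and `g(c) ≠ 0` recovers the value of `x` from it. -/
theorem finite_fibre (g : MvPolynomial ι K) {t : Set A} (htf : t.Finite)
    (ht : Algebra.adjoin K t = ⊤) (hg : ∀ x ∈ t, IsIntegral (MvPolynomial ι K) (g • x))
    (c : ι → K) (hc : eval c g ≠ 0) :
    {φ : A →ₐ[K] K | ∀ i, φ (algebraMap (MvPolynomial ι K) A (X i)) = c i}.Finite := by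
  classical
  have : Finite t := htf
  choose p hpm hp using fun x : t => hg x x.2
  let Z : t → Set K := fun x => {z | (p x).eval₂ (eval c) z = 0}
  have hZ : ∀ x, (Z x).Finite := by
    intro x
    refine ((p x).map (eval c)).roots.toFinset.finite_toSet.subset fun z (hz : _ = _) => ?_
    simpa [((hpm x).map (eval c)).ne_zero, Polynomial.eval_map] using hz
  refine Set.Finite.of_finite_image (f := fun (φ : A →ₐ[K] K) (x : t) => φ (g • (x : A)))
    ((Set.Finite.pi hZ).subset ?_) ?_
  · rintro _ ⟨φ, hφ, rfl⟩ x -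
    have h := congrArg φ (hp x)
    rw [map_zero] at h
    change (p x).eval₂ (eval c) (φ (g • (x : A))) = 0
    rw [← h]
    have h2 := Polynomial.hom_eval₂ (p x) (algebraMap (MvPolynomial ι K) A) (φ : A →+* K)
      (g • (x : A))
    have h3 : (φ : A →+* K).comp (algebraMap (MvPolynomial ι K) A) = eval c :=
      RingHom.ext fun q => algHom_algebraMap_eq_eval φ c hφ q
    rw [h3] at h2
    exact h2.symm
  · intro φ hφ ψ hψ h
    refine AlgHom.ext_of_adjoin_eq_top ht fun x hx => ?_
    have hx' := congrFun h ⟨x, hx⟩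
    simp only [Algebra.smul_def, map_mul, algHom_algebraMap_eq_eval φ c hφ,
      algHom_algebraMap_eq_eval ψ c hψ] at hx'
    exact mul_left_cancel₀ hc hx'

/-- For general `c` the specialized minimal polynomial has simple roots. Each root defines a point
of `R[u] ≅ AdjoinRoot p`, which lifts to `A` because `g(c) ≠ 0`. -/
theorem exists_finite_fibre_card_eq_natDegree_minpoly [IsAlgClosed K] [CharZero K]
    [IsDomain A] [FaithfulSMul (MvPolynomial ι K) A] [Algebra.FiniteType K A] [Algebra.IsAlgebraic (MvPolynomial ι K) A] {u : A}
    (hu : IsIntegral (MvPolynomial ι K) u) :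
    ∃ c : ι → K,
      {φ : A →ₐ[K] K | ∀ i, φ (algebraMap (MvPolynomial ι K) A (X i)) = c i}.Finite ∧
      ∃ T : Finset K, T.card = (minpoly (MvPolynomial ι K) u).natDegree ∧
        ∀ θ ∈ T, ∃ φ : A →ₐ[K] K,
          (∀ i, φ (algebraMap (MvPolynomial ι K) A (X i)) = c i) ∧ φ u = θ := by
  classical
  set R := MvPolynomial ι K with hR
  obtain ⟨t, ht⟩ := (Algebra.FiniteType.out : (⊤ : Subalgebra K A).FG)
  obtain ⟨g, hg0, hg⟩ := Algebra.IsAlgebraic.exists_integral_multiples (R := R) t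
  set p := minpoly R u with hp
  have hpm : p.Monic := minpoly.monic hu
  let B := Algebra.adjoin R ({u} : Set A)
  have huB : u ∈ B := Algebra.subset_adjoin rfl
  let uB : B := ⟨u, huB⟩
  have hder : Polynomial.aeval uB p.derivative ≠ 0 := by
    intro h0
    have h1 : Polynomial.aeval u p.derivative = 0 := by
      have := congrArg (algebraMap B A) h0
      rwa [map_zero, ← Polynomial.aeval_algebraMap_apply] at this
    have hpos : 0 < p.natDegree := minpoly.natDegree_pos hu
    have h2 : p.derivative ≠ 0 := fun h => by
      have := Polynomial.derivative_eq_zero.1 h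
      omega
    exact absurd (minpoly.IsIntegrallyClosed.degree_le_of_ne_zero h2 h1)
      (not_le.2 (Polynomial.degree_derivative_lt hpm.ne_zero))
  have hBalg : Algebra.IsAlgebraic R B :=
    Algebra.IsAlgebraic.of_injective B.val Subtype.val_injective
  -- `h` stands in for the discriminant: a nonzero polynomial divisible by `p'(u)` in `R[u]`. A
  -- double root of `p` specialized at `c` would give a point over `c` where `p'(u)`, hence `h`,
  -- vanishes.
  obtain ⟨h, hh0, v, hv⟩ := (hBalg.isAlgebraic (Polynomial.aeval uB p.derivative)).exists_nonzero_dvd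
    (mem_nonZeroDivisors_of_ne_zero hder)
  obtain ⟨c, hc⟩ : ∃ c : ι → K, eval c (g * h) ≠ 0 := by
    by_contra! hcon
    exact mul_ne_zero hg0 hh0 (MvPolynomial.funext fun c => by simpa using hcon c)
  rw [map_mul] at hc
  have hcg := left_ne_zero_of_mul hc
  have hch := right_ne_zero_of_mul hc
  have hlift : ∀ θ : K, p.eval₂ (eval c) θ = 0 → ∃ ψ : B →ₐ[K] K,
      (∀ r : R, ψ (algebraMap R B r) = eval c r) ∧ ψ uB = θ := by
    intro θ hθ
    let ψ₀ : B →+* K := (AdjoinRoot.lift (eval c) θ hθ).comp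
      ((minpoly.equivAdjoin hu).symm : B →+* AdjoinRoot (minpoly R u))
    have h1 : ∀ r : R, ψ₀ (algebraMap R B r) = eval c r := by
      intro r
      change AdjoinRoot.lift (eval c) θ hθ ((minpoly.equivAdjoin hu).symm (algebraMap R B r)) = _
      rw [AlgEquiv.commutes]
      exact AdjoinRoot.lift_of hθ
    refine ⟨{ ψ₀ with commutes' := fun r => ?_ }, h1, ?_⟩
    · change ψ₀ (algebraMap K B r) = _
      rw [IsScalarTower.algebraMap_apply K R B, h1]
      exact MvPolynomial.eval_C r
    · change AdjoinRoot.lift (eval c) θ hθ ((minpoly.equivAdjoin hu).symm uB) = _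
      have : uB = minpoly.equivAdjoin hu (AdjoinRoot.root _) := by
        apply Subtype.ext
        simp [uB, AdjoinRoot.Minpoly.toAdjoin]
      rw [this, AlgEquiv.symm_apply_apply]
      exact AdjoinRoot.lift_root hθ
  set pc := p.map (eval c) with hpc
  have hpc0 : pc ≠ 0 := (hpm.map _).ne_zero
  have hroot : ∀ θ ∈ pc.roots, p.eval₂ (eval c) θ = 0 := fun θ hθ => by
    rw [Polynomial.mem_roots hpc0, Polynomial.IsRoot, Polynomial.eval_map] at hθ
    exact hθ
  have hnodup : pc.roots.Nodup := by
    rw [Multiset.nodup_iff_count_le_one]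
    intro θ
    rw [Polynomial.count_roots]
    by_contra! hlt
    obtain ⟨h1, h2⟩ := (Polynomial.one_lt_rootMultiplicity_iff_isRoot hpc0).1 hlt
    rw [Polynomial.IsRoot, hpc, Polynomial.eval_map] at h1
    obtain ⟨ψ, hψ, hψu⟩ := hlift θ h1
    have h3 := congrArg ψ hv
    rw [hψ, map_mul] at h3
    have h4 : ψ (Polynomial.aeval uB p.derivative) = 0 := by
      have e := Polynomial.hom_eval₂ p.derivative (algebraMap R B) (ψ : B →+* K) uB
      have e2 : (ψ : B →+* K).comp (algebraMap R B) = eval c := RingHom.ext hψ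
      rw [e2] at e
      refine e.trans ?_
      rw [Polynomial.IsRoot, hpc, Polynomial.derivative_map, Polynomial.eval_map] at h2
      simpa [hψu] using h2
    rw [h4, zero_mul] at h3
    exact hch h3
  refine ⟨c, finite_fibre g t.finite_toSet ht hg c hcg, pc.roots.toFinset, ?_, ?_⟩
  · rw [Multiset.toFinset_card_of_nodup hnodup, ← hpm.natDegree_map (eval c)]
    exact (IsAlgClosed.splits pc).natDegree_eq_card_roots.symm
  · intro θ hθ
    obtain ⟨ψ, hψ, hψu⟩ := hlift θ (hroot θ (Multiset.mem_toFinset.1 hθ))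
    obtain ⟨φ, hφ⟩ := exists_algHom_of_isIntegral_smul (B := B) (A := A) (algebraMap R B g) ht
      (fun x hx => by
        have := (hg x hx).tower_top (A := B)
        rwa [algebraMap_smul]) ψ (by rw [hψ]; exact hcg)
    refine ⟨φ, fun i => ?_, ?_⟩
    · rw [IsScalarTower.algebraMap_apply R B A, hφ, hψ]; simp
    · exact (hφ uB).trans hψu

end Fibre

/-! ### Shears making a polynomial monic in one variable, up to a unit -/

section Shear

open MvPolynomial

variable {K ι σ : Type*} [Field K]

theorem coeff_aeval_C_mul_X (a : σ → K) (F : MvPolynomial σ K) (n : ℕ) :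
    (aeval (fun i => Polynomial.C (a i) * Polynomial.X) F).coeff n =
      eval a (homogeneousComponent n F) := by
  induction F using MvPolynomial.induction_on' with
  | monomial s r =>
    rw [homogeneousComponent_of_mem (isHomogeneous_monomial r rfl), aeval_monomial]
    simp_rw [Finsupp.prod, mul_pow, Finset.prod_mul_distrib, Finset.prod_pow_eq_pow_sum,
      ← Polynomial.C_pow, ← map_prod]
    rw [← mul_assoc, Polynomial.algebraMap_apply, ← Polynomial.C_mul, Polynomial.coeff_C_mul_X_pow,
      Finsupp.degree_apply]
    split_ifs <;> simp [eval_monomial, Finsupp.prod]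
  | add p q hp hq => simp [hp, hq]

theorem homogeneousComponent_totalDegree_ne_zero {F : MvPolynomial σ K} (hF : F ≠ 0) :
    homogeneousComponent F.totalDegree F ≠ 0 := by
  obtain ⟨s, hs, hsd⟩ := Finset.exists_mem_eq_sup F.support (support_nonempty.2 hF)
    fun s => s.sum fun _ e => e
  intro h
  have := congrArg (coeff s) h
  rw [coeff_homogeneousComponent, if_pos, coeff_zero] at this
  · exact mem_support_iff.1 hs this
  · exact hsd.symm

theorem totalDegree_aeval_le_of_totalDegree_le_one {τ : Type*} (f : σ → MvPolynomial τ K)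
    (hf : ∀ i, (f i).totalDegree ≤ 1) (F : MvPolynomial σ K) :
    (aeval f F).totalDegree ≤ F.totalDegree := by
  rw [aeval_def, eval₂_eq]
  refine totalDegree_finsetSum_le fun s hs => ?_
  refine (totalDegree_mul _ _).trans ?_
  rw [algebraMap_eq, totalDegree_C, zero_add]
  refine (totalDegree_finsetProd _ _).trans ?_
  refine le_trans (Finset.sum_le_sum fun i _ => ?_) (le_totalDegree hs)
  exact (totalDegree_pow _ _).trans (by simpa using Nat.mul_le_mul_left (s i) (hf i))

/-- The product of `G` with the variable `none` is nonzero, so `G` is nonzero at some point whose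
`none` coordinate is nonzero; by homogeneity that coordinate can be scaled to 1. -/
theorem exists_eval_elim_one_ne_zero [Infinite K] {G : MvPolynomial (Option ι) K}
    {d : ℕ} (hG : G.IsHomogeneous d) (hG0 : G ≠ 0) :
    ∃ α : ι → K, eval (fun o : Option ι => o.elim 1 α) G ≠ 0 := by
  by_contra! h
  refine mul_ne_zero hG0 (X_ne_zero (none : Option ι)) (MvPolynomial.funext fun b => ?_)
  rw [map_mul, eval_X, map_zero]
  by_cases hb : b none = 0
  · rw [hb, mul_zero]
  · have hb' : b = fun o => b none * o.elim 1 (fun i => b (some i) / b none) := by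
      funext o
      cases o with
      | none => simp
      | some i => simp [mul_div_cancel₀ _ hb]
    have key : eval b G = b none ^ d * eval (fun o => o.elim 1 (fun i => b (some i) / b none)) G := by
      conv_lhs => rw [hb']
      rw [eval_eq, eval_eq, Finset.mul_sum]
      refine Finset.sum_congr rfl fun s hs => ?_
      have hs' : s.degree = d := by
        rw [Finsupp.degree_eq_weight_one]
        exact hG (mem_support_iff.1 hs)
      simp_rw [mul_pow, Finset.prod_mul_distrib, Finset.prod_pow_eq_pow_sum]
      rw [← hs', Finsupp.degree_apply]
      exact mul_left_comm _ _ _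
    rw [key, h, mul_zero, zero_mul]

/-- The automorphism of `K[W, T]` fixing `T` and sending `W i` to `W i + α i * T`. -/
noncomputable def shear (α : ι → K) :
    MvPolynomial (Option ι) K ≃ₐ[K] MvPolynomial (Option ι) K :=
  AlgEquiv.ofAlgHom
    (aeval fun o => o.elim (X none) fun i => X (some i) + C (α i) * X none)
    (aeval fun o => o.elim (X none) fun i => X (some i) - C (α i) * X none)
    (by ext o; cases o <;> simp [algHom_C, algebraMap_eq])
    (by ext o; cases o <;> simp [algHom_C, algebraMap_eq])

theorem shear_apply (α : ι → K) (F : MvPolynomial (Option ι) K) :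
    shear α F = aeval (fun o => o.elim (X none) fun i => X (some i) + C (α i) * X none) F := rfl

theorem totalDegree_shear_le (α : ι → K) (F : MvPolynomial (Option ι) K) :
    (shear α F).totalDegree ≤ F.totalDegree := by
  refine totalDegree_aeval_le_of_totalDegree_le_one _ (fun o => ?_) F
  cases o with
  | none => simp
  | some i =>
    refine (totalDegree_add _ _).trans (max_le (by simp) ((totalDegree_mul _ _).trans ?_))
    simp

theorem map_eval_zero_optionEquivLeft_shear (α : ι → K) (F : MvPolynomial (Option ι) K) :
    (optionEquivLeft K ι (shear α F)).map (eval 0) =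
      aeval (fun o : Option ι => Polynomial.C (o.elim 1 α) * Polynomial.X) F := by
  have h : ((Polynomial.mapAlgHom (aeval (0 : ι → K))).comp
      (optionEquivLeft K ι : MvPolynomial (Option ι) K →ₐ[K] _)).comp
        (shear α : MvPolynomial (Option ι) K →ₐ[K] _) =
      aeval (fun o : Option ι => Polynomial.C (o.elim 1 α) * Polynomial.X) := by
    ext o : 1
    cases o <;> simp [shear_apply, optionEquivLeft_X_none, optionEquivLeft_X_some,
      optionEquivLeft_C]
  rw [← h]
  simp

/-- Setting the other variables to 0 in the sheared polynomial restricts `F` to the line through the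
origin in direction `(1, α)`. If the top form of `F` is nonzero there, the coefficient of `T ^
totalDegree F` is nonzero; the total degree leaves room only for a constant, hence a unit. -/
theorem exists_shear_natDegree_eq_totalDegree [Infinite K] {F : MvPolynomial (Option ι) K}
    (hF : F ≠ 0) : ∃ α : ι → K,
      (optionEquivLeft K ι (shear α F)).natDegree = F.totalDegree ∧
      IsUnit (optionEquivLeft K ι (shear α F)).leadingCoeff := by
  obtain ⟨α, hα⟩ := exists_eval_elim_one_ne_zero
    (homogeneousComponent_isHomogeneous F.totalDegree F) (homogeneousComponent_totalDegree_ne_zero hF)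
  refine ⟨α, ?_⟩
  set q := optionEquivLeft K ι (shear α F) with hq
  have hle : q.natDegree ≤ F.totalDegree := by
    rw [hq, natDegree_optionEquivLeft]
    exact (degreeOf_le_totalDegree _ _).trans (totalDegree_shear_le α F)
  have hcoeff : eval 0 (q.coeff F.totalDegree) ≠ 0 := by
    rw [← coeff_aeval_C_mul_X, ← map_eval_zero_optionEquivLeft_shear, Polynomial.coeff_map] at hα
    exact hα
  have hne : q.coeff F.totalDegree ≠ 0 := fun h => hcoeff (by rw [h, map_zero])
  have hdeg : q.natDegree = F.totalDegree := le_antisymm hle (Polynomial.le_natDegree_of_ne_zero hne)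
  refine ⟨hdeg, ?_⟩
  rw [Polynomial.leadingCoeff, hdeg]
  have htot : (shear α F).totalDegree = F.totalDegree := by
    refine le_antisymm (totalDegree_shear_le α F) ?_
    rw [← hdeg, hq, natDegree_optionEquivLeft]
    exact degreeOf_le_totalDegree _ _
  have h0 := totalDegree_coeff_optionEquivLeft_add_le _ _ (shear α F) F.totalDegree htot.ge
  rw [htot, ← hq] at h0
  have h1 : (q.coeff F.totalDegree).totalDegree = 0 := by omega
  rw [totalDegree_eq_zero_iff_eq_C] at h1
  rw [h1]
  refine (IsUnit.mk0 _ fun h => hne ?_).map C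
  rw [h1, h, map_zero]

end Shear

/-! ### Shearing a transcendence basis -/

section TranscendenceBasis

open MvPolynomial

variable {K A ι : Type*} [Field K] [CommRing A] [Algebra K A]

/-- The `K[X_i]`-algebra structure on `A` sending `X i` to `w i`. -/
noncomputable abbrev algebraOfFamily (w : ι → A) : Algebra (MvPolynomial ι K) A :=
  (aeval (R := K) w).toAlgebra

theorem isScalarTower_algebraOfFamily (w : ι → A) :
    letI := algebraOfFamily (K := K) w
    IsScalarTower K (MvPolynomial ι K) A :=
  letI := algebraOfFamily (K := K) w
  IsScalarTower.of_algebraMap_eq fun r => ((aeval (R := K) w).commutes r).symm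

theorem faithfulSMul_algebraOfFamily {w : ι → A} (hw : AlgebraicIndependent K w) :
    letI := algebraOfFamily (K := K) w
    FaithfulSMul (MvPolynomial ι K) A :=
  letI := algebraOfFamily (K := K) w
  (faithfulSMul_iff_algebraMap_injective _ _).2 hw

theorem isAlgebraic_algebraOfFamily [IsDomain A] {w : ι → A} (hw : IsTranscendenceBasis K w) :
    letI := algebraOfFamily (K := K) w
    Algebra.IsAlgebraic (MvPolynomial ι K) A := by
  let _ := algebraOfFamily (K := K) w
  have := hw.isAlgebraic
  rw [Algebra.adjoin_range_eq_range_aeval] at this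
  exact Algebra.IsAlgebraic.of_ringHom_of_comp_eq
    (S := (aeval (R := K) w).range) (B := A) (aeval (R := K) w).rangeRestrict (RingHom.id A)
    (AlgHom.rangeRestrict_surjective _) Function.injective_id rfl

theorem aeval_elim_eq_aeval_optionEquivLeft (w : ι → A) (u : A) (F : MvPolynomial (Option ι) K) :
    letI := algebraOfFamily (K := K) w
    Polynomial.aeval u (optionEquivLeft K ι F) = aeval (fun o : Option ι => o.elim u w) F := by
  let _ := algebraOfFamily (K := K) w
  have := isScalarTower_algebraOfFamily (K := K) w
  have h : ((Polynomial.aeval (R := MvPolynomial ι K) u).restrictScalars K).comp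
      (optionEquivLeft K ι : MvPolynomial (Option ι) K →ₐ[K] _) =
      aeval (fun o : Option ι => o.elim u w) := by
    ext o
    cases o
    · simp [optionEquivLeft_X_none]
    · simp [optionEquivLeft_X_some]
      exact aeval_X _ _
  rw [← h]; rfl

theorem aeval_elim_sub_shear (W : ι → A) (u : A) (α : ι → K) (F : MvPolynomial (Option ι) K) :
    aeval (fun o : Option ι => o.elim u fun i => W i - α i • u) (shear α F) =
      aeval (fun o : Option ι => o.elim u W) F := by
  have h : (aeval (fun o : Option ι => o.elim u fun i => W i - α i • u)).comp
      (shear α : MvPolynomial (Option ι) K →ₐ[K] _) = aeval (fun o : Option ι => o.elim u W) := by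
    ext o
    cases o <;> simp [shear_apply, algHom_C, Algebra.smul_def]
  rw [← h]; rfl

theorem isIntegral_adjoin_range {w : ι → A} {u : A}
    (hu : letI := algebraOfFamily (K := K) w; IsIntegral (MvPolynomial ι K) u) :
    IsIntegral (Algebra.adjoin K (Set.range w)) u := by
  rw [Algebra.adjoin_range_eq_range_aeval]
  obtain ⟨p, hm, hp⟩ := hu
  refine ⟨p.map ((aeval (R := K) w).rangeRestrict : MvPolynomial ι K →+* _), hm.map _, ?_⟩
  rw [Polynomial.eval₂_map]
  exact hp

/-- Each `W i` is the sum of the new `w i` and a multiple of `u`, so it is algebraic over the `w i`.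
The new family thus spans in the algebraic matroid, and it has only as many members as the
transcendence degree. -/
theorem isTranscendenceBasis_sub_smul [IsDomain A] [Finite ι] {W : ι → A}
    (hW : IsTranscendenceBasis K W) {u : A} {α : ι → K}
    (hu : IsAlgebraic (Algebra.adjoin K (Set.range fun i => W i - α i • u)) u) :
    IsTranscendenceBasis K fun i => W i - α i • u := by
  set w := fun i => W i - α i • u with hw
  set C := Subalgebra.algebraicClosure (Algebra.adjoin K (Set.range w)) A with hC
  have hcl : (AlgebraicIndependent.matroid K A).closure (Set.range w) = C :=
    AlgebraicIndependent.matroid_closure_eq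
  have hmem : ∀ i, W i ∈ C := by
    intro i
    have h1 : w i ∈ C := by
      rw [hC, Subalgebra.mem_algebraicClosure]
      exact isAlgebraic_algebraMap
        (⟨w i, Algebra.subset_adjoin ⟨i, rfl⟩⟩ : Algebra.adjoin K (Set.range w))
    have h2 : α i • u ∈ C := by
      rw [← algebraMap_smul (Algebra.adjoin K (Set.range w)) (α i) u]
      exact C.smul_mem hu _
    have h3 : W i = w i + α i • u := (sub_add_cancel _ _).symm
    exact h3 ▸ C.add_mem h1 h2
  have hsp : (AlgebraicIndependent.matroid K A).Spanning (Set.range w) := by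
    have hWs : (AlgebraicIndependent.matroid K A).Spanning (Set.range W) :=
      AlgebraicIndependent.matroid_spanning_iff.2 hW.isAlgebraic
    rw [Matroid.spanning_iff_ground_subset_closure (by simp)] at hWs ⊢
    refine hWs.trans (Matroid.closure_subset_closure_of_subset_closure ?_)
    rw [hcl]
    rintro _ ⟨i, rfl⟩
    exact hmem i
  have := AlgebraicIndependent.matroid_spanning_iff.1 hsp
  exact Algebra.IsAlgebraic.isTranscendenceBasis_of_lift_le_trdeg_of_finite K w
    hW.lift_cardinalMk_eq_trdeg.le

theorem exists_shear_fibre_card_eq_totalDegree [IsAlgClosed K] [CharZero K] [IsDomain A]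
    [Algebra.FiniteType K A] [Finite ι] {W : ι → A} (hW : IsTranscendenceBasis K W) {u : A}
    {F : MvPolynomial (Option ι) K} (hF : Irreducible F)
    (hFu : aeval (fun o : Option ι => o.elim u W) F = 0) :
    ∃ α c : ι → K, IsTranscendenceBasis K (fun i => W i - α i • u) ∧
      {φ : A →ₐ[K] K | ∀ i, φ (W i - α i • u) = c i}.Finite ∧
      ∃ T : Finset K, T.card = F.totalDegree ∧
        ∀ θ ∈ T, ∃ φ : A →ₐ[K] K, (∀ i, φ (W i - α i • u) = c i) ∧ φ u = θ := by
  have : Infinite K := IsAlgClosed.instInfinite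
  obtain ⟨α, hdeg, hunit⟩ := exists_shear_natDegree_eq_totalDegree hF.ne_zero
  set q := optionEquivLeft K ι (shear α F) with hq
  let w := fun i => W i - α i • u
  let _ := algebraOfFamily (K := K) w
  have := isScalarTower_algebraOfFamily (K := K) w
  have hqu : Polynomial.aeval u q = 0 := by
    rw [hq, aeval_elim_eq_aeval_optionEquivLeft, aeval_elim_sub_shear, hFu]
  have hu : IsIntegral (MvPolynomial ι K) u := by
    have h := (isIntegral_leadingCoeff_smul q u hqu).smul ((hunit.unit⁻¹ : (MvPolynomial ι K)ˣ) :
      MvPolynomial ι K)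
    simpa [smul_smul] using h
  have hw : IsTranscendenceBasis K w :=
    isTranscendenceBasis_sub_smul hW (isIntegral_adjoin_range hu).isAlgebraic
  have := faithfulSMul_algebraOfFamily hw.1
  have := isAlgebraic_algebraOfFamily hw
  have hqirr : Irreducible q := (hF.map (shear α)).map (optionEquivLeft K ι)
  -- The irreducible `q` is a multiple of the minimal polynomial, so the two differ by a unit.
  have hmin : (minpoly (MvPolynomial ι K) u).natDegree = F.totalDegree := by
    obtain ⟨p, hp⟩ := minpoly.isIntegrallyClosed_dvd hu hqu
    have hpu : IsUnit p := (hqirr.isUnit_or_isUnit hp).resolve_left (minpoly.not_isUnit _ _)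
    rw [← hdeg, hp, Polynomial.natDegree_mul (minpoly.ne_zero hu) hpu.ne_zero,
      Polynomial.natDegree_eq_zero_of_isUnit hpu, add_zero]
  obtain ⟨c, hfin, T, hT, hTφ⟩ := exists_finite_fibre_card_eq_natDegree_minpoly hu
  have hX : ∀ i, algebraMap (MvPolynomial ι K) A (X i) = W i - α i • u := fun i => aeval_X w i
  simp only [hX] at hfin hTφ
  exact ⟨α, c, hw, hfin, T, hT.trans hmin, hTφ⟩

end TranscendenceBasis

/-! ### Coordinate rings, linear sections and the degree bound -/

section Geometry

open MvPolynomial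

variable {K σ : Type*} [Field K]

theorem IsZariskiClosed.zeroLocus_vanishingIdeal {V : Set (σ → K)} (hV : IsZariskiClosed V) :
    zeroLocus K (vanishingIdeal K V) = V := by
  obtain ⟨I, rfl⟩ := hV
  exact zeroLocus_vanishingIdeal_galoisConnection.l_u_l_eq_l I

theorem isZariskiClosed_setOf_eval_eq_zero (f : MvPolynomial σ K) :
    IsZariskiClosed {x : σ → K | eval x f = 0} :=
  ⟨Ideal.span {f}, by simp [zeroLocus_span, aeval_eq_eval]⟩

theorem IsIrreducibleClosed.isPrime {V : Set (σ → K)} (hV : IsIrreducibleClosed V) :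
    (vanishingIdeal K V).IsPrime := by
  obtain ⟨-, ⟨x, hx⟩, h⟩ := hV
  refine ⟨fun htop => ?_, fun {f g} hfg => ?_⟩
  · have : (1 : MvPolynomial σ K) ∈ vanishingIdeal K V := htop ▸ Submodule.mem_top
    simpa using this x hx
  · refine (h _ _ (isZariskiClosed_setOf_eval_eq_zero f) (isZariskiClosed_setOf_eval_eq_zero g)
      fun x hx => ?_).imp (fun h x hx => ?_) (fun h x hx => ?_)
    · have := hfg x hx
      rw [map_mul, mul_eq_zero] at this
      simpa [aeval_eq_eval] using this
    · simpa [aeval_eq_eval] using h hx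
    · simpa [aeval_eq_eval] using h hx

theorem isIrreducibleClosed_zeroLocus [IsAlgClosed K] [Finite σ] (P : Ideal (MvPolynomial σ K))
    [hP : P.IsPrime] : IsIrreducibleClosed (zeroLocus K P) := by
  refine ⟨⟨P, rfl⟩, ?_, ?_⟩
  · by_contra hne
    rw [Set.not_nonempty_iff_eq_empty] at hne
    have := IsPrime.vanishingIdeal_zeroLocus (K := K) P
    rw [hne, vanishingIdeal_empty] at this
    exact hP.ne_top this.symm
  · rintro A B ⟨I, rfl⟩ ⟨J, rfl⟩ hAB
    have hmul : I * J ≤ P := by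
      rw [← IsPrime.vanishingIdeal_zeroLocus (K := K) P, Ideal.mul_le]
      intro f hf g hg x hx
      rw [map_mul]
      rcases hAB hx with h | h
      · rw [h f hf, zero_mul]
      · rw [h g hg, mul_zero]
    exact (hP.mul_le.1 hmul).imp (fun h => zeroLocus_anti_mono h) (fun h => zeroLocus_anti_mono h)

theorem exists_point_of_algHom {V : Set (σ → K)} (hV : IsZariskiClosed V)
    (φ : (MvPolynomial σ K ⧸ vanishingIdeal K V) →ₐ[K] K) :
    ∃ x ∈ V, ∀ p, φ (Ideal.Quotient.mk _ p) = eval x p := by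
  let x : σ → K := fun i => φ (Ideal.Quotient.mk _ (X i))
  have h : φ.comp (Ideal.Quotient.mkₐ K (vanishingIdeal K V)) = aeval x := by
    ext i; simp [x]
  have h' : ∀ p, φ (Ideal.Quotient.mk _ p) = eval x p := fun p => by
    simpa [aeval_eq_eval] using DFunLike.congr_fun h p
  refine ⟨x, ?_, h'⟩
  rw [← hV.zeroLocus_vanishingIdeal]
  intro p hp
  rw [aeval_eq_eval]
  exact (h' p).symm.trans (by rw [Ideal.Quotient.eq_zero_iff_mem.2 hp, map_zero])

/-- Evaluation at a point of `V` as a homomorphism on the coordinate ring. -/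
noncomputable def evalAt {V : Set (σ → K)} {x : σ → K} (hx : x ∈ V) :
    (MvPolynomial σ K ⧸ vanishingIdeal K V) →ₐ[K] K :=
  Ideal.Quotient.liftₐ _ (aeval x) fun _ hp => hp x hx

theorem evalAt_mk {V : Set (σ → K)} {x : σ → K} (hx : x ∈ V) (p : MvPolynomial σ K) :
    evalAt hx (Ideal.Quotient.mk _ p) = eval x p := by
  simp [evalAt]

theorem dim_eq_card {ι : Type*} [Fintype ι] {V : Set (σ → K)} (hV : IsIrreducibleClosed V)
    {w : ι → MvPolynomial σ K ⧸ vanishingIdeal K V} (hw : IsTranscendenceBasis K w) :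
    dim V = Fintype.card ι := by
  have := hV.isPrime
  have h := hw.lift_cardinalMk_eq_trdeg
  have h2 := congrArg Cardinal.toNat h
  rw [Cardinal.toNat_lift, Cardinal.toNat_lift] at h2
  rw [dim, ← h2]
  simp

variable [Fintype σ]

/-- The homogeneous linear form with given coefficients. -/
noncomputable def linearForm : (σ → K) →ₗ[K] MvPolynomial σ K :=
  Fintype.linearCombination K (X (R := K))

theorem eval_linearForm (a x : σ → K) : eval x (linearForm a) = a ⬝ᵥ x := by
  simp [linearForm, Fintype.linearCombination_apply, dotProduct]

theorem linearForm_single [DecidableEq σ] (i : σ) :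
    linearForm (Pi.single i (1 : K)) = X i := by
  simp [linearForm]

/-- The fibre supplied by `exists_shear_fibre_card_eq_totalDegree` is cut out on `V` by the
equations `w i ⬝ᵥ x = c i`. Algebraic independence makes the `w i` linearly independent, so these
equations define an affine subspace `E` of codimension `dim V`. It competes in the supremum, and the
values of `u` separate at least `totalDegree F` points of `V ∩ E`. -/
theorem totalDegree_le_irredDegree [IsAlgClosed K] [CharZero K] {ι : Type*} [Finite ι]
    {V : Set (σ → K)} (hV : IsIrreducibleClosed V) (W : ι → σ → K) (u : σ → K)
    (hW : IsTranscendenceBasis K fun i => Ideal.Quotient.mk (vanishingIdeal K V)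
      (linearForm (W i)))
    {F : MvPolynomial (Option ι) K} (hF : Irreducible F)
    (hFu : aeval (fun o : Option ι => o.elim (Ideal.Quotient.mk (vanishingIdeal K V)
      (linearForm u)) fun i => Ideal.Quotient.mk (vanishingIdeal K V) (linearForm (W i))) F = 0) :
    (F.totalDegree : ℕ∞) ≤ irredDegree V := by
  have := Fintype.ofFinite ι
  have := hV.isPrime
  obtain ⟨α, c, hw, hfin, T, hT, hTφ⟩ := exists_shear_fibre_card_eq_totalDegree hW hF hFu
  let w : ι → σ → K := fun i => W i - α i • u
  have hwmk : ∀ i, Ideal.Quotient.mk (vanishingIdeal K V) (linearForm (w i)) =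
      Ideal.Quotient.mk (vanishingIdeal K V) (linearForm (W i)) -
        α i • Ideal.Quotient.mk (vanishingIdeal K V) (linearForm u) := by
    intro i
    simp only [w, map_sub, map_smul]
    rfl
  simp only [← hwmk] at hw hfin hTφ
  let L : (σ → K) →ₗ[K] (ι → K) := (Matrix.of w).mulVecLin
  have hLapply : ∀ x i, L x i = w i ⬝ᵥ x := fun x i => rfl
  have hlin : LinearIndependent K w := by
    have h := hw.1.linearIndependent
    exact LinearIndependent.of_comp
      (((Ideal.Quotient.mkₐ K (vanishingIdeal K V)).toLinearMap).comp linearForm) h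
  have hLsurj : LinearMap.range L = ⊤ := by
    apply Submodule.eq_top_of_finrank_eq
    have h : (Matrix.of w).rank = Fintype.card ι := hlin.rank_matrix
    rw [Matrix.rank] at h
    rw [h, Module.finrank_fintype_fun_eq_card]
  obtain ⟨x₀, hx₀⟩ : ∃ x₀, L x₀ = c := LinearMap.range_eq_top.1 hLsurj c
  let E := AffineSubspace.mk' x₀ (LinearMap.ker L)
  have hE : ∀ x, x ∈ E ↔ ∀ i, w i ⬝ᵥ x = c i := by
    intro x
    rw [AffineSubspace.mem_mk', vsub_eq_sub, LinearMap.mem_ker, map_sub, hx₀, sub_eq_zero,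
      funext_iff]
    simp only [hLapply]
  have hEdim : Module.finrank K E.direction + dim V = Fintype.card σ := by
    rw [AffineSubspace.direction_mk', dim_eq_card hV hw]
    have h := LinearMap.finrank_range_add_finrank_ker L
    rw [hLsurj, finrank_top, Module.finrank_fintype_fun_eq_card,
      Module.finrank_fintype_fun_eq_card] at h
    omega
  have hVE : (V ∩ (E : Set (σ → K))).Finite := by
    rw [← Set.finite_coe_iff]
    have := hfin.to_subtype
    refine Finite.of_injective (β := {φ : (MvPolynomial σ K ⧸ vanishingIdeal K V) →ₐ[K] K |
      ∀ i, φ (Ideal.Quotient.mk (vanishingIdeal K V) (linearForm (w i))) = c i})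
      (fun x => ⟨evalAt x.2.1, fun i => ?_⟩) fun x y hxy => ?_
    · rw [evalAt_mk, eval_linearForm]
      exact (hE x).1 x.2.2 i
    · refine Subtype.ext (funext fun i => ?_)
      have h := DFunLike.congr_fun (congrArg Subtype.val hxy) (Ideal.Quotient.mk _ (X i))
      simpa only [evalAt_mk, eval_X] using h
  have hcard : (T.card : ℕ∞) ≤ (V ∩ (E : Set (σ → K))).encard := by
    rw [← Set.encard_coe_eq_coe_finsetCard]
    refine (Set.encard_le_encard fun θ hθ => ?_).trans
      (Set.encard_image_le (fun x => u ⬝ᵥ x) (V ∩ (E : Set (σ → K))))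
    obtain ⟨φ, hφ, hφu⟩ := hTφ θ hθ
    obtain ⟨x, hxV, hx⟩ := exists_point_of_algHom hV.1 φ
    refine ⟨x, ⟨hxV, (hE x).2 fun i => ?_⟩, ?_⟩
    · rw [← hφ i, hx, eval_linearForm]
    · change u ⬝ᵥ x = θ
      rw [← hφu, hx, eval_linearForm]
  rw [← hT]
  exact hcard.trans (le_iSup_of_le E (le_iSup_of_le ⟨x₀, AffineSubspace.self_mem_mk' _ _⟩
    (le_iSup_of_le hEdim (le_iSup_of_le hVE le_rfl))))

end Geometry

/-! ### Schwartz–Zippel and irreducible relations -/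

section Polynomials

open MvPolynomial

variable {K : Type*} [Field K]

theorem card_zeros_mul_card_le [DecidableEq K] {τ : Type*} [Fintype τ] [DecidableEq τ]
    {p : MvPolynomial τ K} (hp : p ≠ 0) (S : Finset K) (M : Finset (τ → K))
    (hM : ∀ a ∈ M, (∀ j, a j ∈ S) ∧ eval a p = 0) :
    M.card * S.card ≤ p.totalDegree * S.card ^ Fintype.card τ := by
  rcases S.eq_empty_or_nonempty with rfl | hS
  · simp
  have hS0 : (0 : ℚ≥0) < S.card := by exact_mod_cast hS.card_pos
  let e := Fintype.equivFin τ
  have h := schwartz_zippel_totalDegree (p := renameEquiv K e p)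
    ((map_ne_zero_iff _ (renameEquiv K e).injective).2 hp) S
  rw [totalDegree_renameEquiv, div_le_div_iff₀ (by positivity) hS0] at h
  refine le_trans (Nat.mul_le_mul_right _ ?_) (by exact_mod_cast h)
  refine Finset.card_le_card_of_injOn (fun a => a ∘ e.symm) (fun a ha => ?_) fun a _ b _ hab => ?_
  · obtain ⟨h1, h2⟩ := hM a ha
    simp only [Finset.coe_filter, Fintype.mem_piFinset, Set.mem_ofPred_eq]
    refine ⟨fun i => h1 _, ?_⟩
    rw [renameEquiv_apply, eval_rename, Function.comp_assoc, Equiv.symm_comp_self]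
    exact h2
  · funext i
    simpa using congrFun hab (e i)

/-- Degrees in each variable add under multiplication, so the factors of a renamed polynomial
involve only variables in the range of `f`. -/
theorem irreducible_rename {τ υ : Type*} {f : τ → υ} (hf : Function.Injective f)
    {p : MvPolynomial τ K} (hp : Irreducible p) : Irreducible (rename f p) := by
  classical
  have hinj := rename_injective (R := K) f hf
  refine ⟨fun h => hp.not_isUnit ?_, fun a b hab => ?_⟩
  · have := h.map (killCompl hf : MvPolynomial υ K →ₐ[K] MvPolynomial τ K)
    rwa [killCompl_rename_app] at this
  · have h0 : a * b ≠ 0 := hab ▸ (map_ne_zero_iff _ hinj).2 hp.ne_zero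
    have hvars : ∀ i, i ∉ Set.range f → degreeOf i (a * b) = 0 := by
      intro i hi
      rw [← hab]
      by_contra h
      obtain ⟨j, -, rfl⟩ := Finset.mem_image.1 (vars_rename f p (mem_vars_iff_degreeOf_ne_zero.2 h))
      exact hi ⟨j, rfl⟩
    have ha : ∃ a', rename f a' = a := exists_rename_eq_of_vars_subset_range a f hf fun i hi => by
      by_contra hri
      have := hvars i hri
      rw [degreeOf_mul_eq (left_ne_zero_of_mul h0) (right_ne_zero_of_mul h0)] at this
      exact mem_vars_iff_degreeOf_ne_zero.1 hi (by omega)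
    have hb : ∃ b', rename f b' = b := exists_rename_eq_of_vars_subset_range b f hf fun i hi => by
      by_contra hri
      have := hvars i hri
      rw [degreeOf_mul_eq (left_ne_zero_of_mul h0) (right_ne_zero_of_mul h0)] at this
      exact mem_vars_iff_degreeOf_ne_zero.1 hi (by omega)
    obtain ⟨a', rfl⟩ := ha
    obtain ⟨b', rfl⟩ := hb
    rw [← map_mul] at hab
    exact (hp.isUnit_or_isUnit (hinj hab)).imp (fun h => h.map _) (fun h => h.map _)

theorem exists_irreducible_aeval_eq_zero {A τ : Type*} [CommRing A] [IsDomain A] [Algebra K A]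
    {v : τ → A} (hv : ¬ AlgebraicIndependent K v) :
    ∃ F : MvPolynomial τ K, Irreducible F ∧ aeval v F = 0 := by
  rw [algebraicIndependent_iff] at hv
  push Not at hv
  obtain ⟨F, hF, hF0⟩ := hv
  obtain ⟨s, hs, c, hc⟩ := WfDvdMonoid.exists_factors F hF0
  have h := congrArg (aeval v) hc
  rw [map_mul, hF, mul_eq_zero, map_multiset_prod, Multiset.prod_eq_zero_iff] at h
  rcases h with h | h
  · obtain ⟨G, hG, hG0⟩ := Multiset.mem_map.1 h
    exact ⟨G, hs G hG, hG0⟩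
  · exact absurd h (c.isUnit.map (aeval v)).ne_zero

end Polynomials

/-! ### Transcendence bases made of coordinate functions -/

section Coordinates

open MvPolynomial

variable {K σ : Type*} [Field K]

theorem adjoin_range_mk_X (P : Ideal (MvPolynomial σ K)) :
    Algebra.adjoin K (Set.range fun i => Ideal.Quotient.mk P (X i)) = ⊤ := by
  have h := congrArg (Subalgebra.map (Ideal.Quotient.mkₐ K P)) (adjoin_range_X (R := K) (σ := σ))
  rw [AlgHom.map_adjoin, ← Set.range_comp, Algebra.map_top,
    (AlgHom.range_eq_top _).2 (Ideal.Quotient.mkₐ_surjective K P)] at h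
  exact h

theorem exists_isTranscendenceBasis_sumElim_coordinates [Finite σ] {P : Ideal (MvPolynomial σ K)}
    [P.IsPrime] {J : Type*} {e : J → σ}
    (he : AlgebraicIndependent K fun j => Ideal.Quotient.mk P (X (e j))) :
    ∃ (n : ℕ) (e' : Fin n → σ),
      IsTranscendenceBasis K fun i : J ⊕ Fin n => Ideal.Quotient.mk P (X (Sum.elim e e' i)) := by
  have halg : Algebra.IsAlgebraic
      (Algebra.adjoin K (Set.range fun i => Ideal.Quotient.mk P (X i))) (MvPolynomial σ K ⧸ P) := by
    rw [adjoin_range_mk_X]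
    exact ⟨fun a => isAlgebraic_algebraMap (⟨a, Algebra.mem_top⟩ : (⊤ : Subalgebra K _))⟩
  obtain ⟨u, hsu, hut, hu⟩ := exists_isTranscendenceBasis_between
    (Set.range fun j => Ideal.Quotient.mk P (X (e j)))
    (Set.range fun i => Ideal.Quotient.mk P (X (R := K) i))
    (by rintro _ ⟨j, rfl⟩; exact ⟨e j, rfl⟩) he.to_subtype_range
  have hufin : u.Finite := (Set.finite_range _).subset hut
  have : Finite (u \ Set.range fun j => Ideal.Quotient.mk P (X (e j)) : Set _) :=
    (hufin.subset Set.sdiff_subset).to_subtype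
  obtain ⟨n, ⟨ε⟩⟩ := Finite.exists_equiv_fin
    (u \ Set.range fun j => Ideal.Quotient.mk P (X (e j)) : Set _)
  choose e' he' using fun i : Fin n => hut (ε.symm i).2.1
  refine ⟨n, e', .of_subtype_range ?_ ?_⟩
  · rintro (i | i) (j | j) hij
    · exact congrArg Sum.inl (he.injective hij)
    · exact absurd ⟨i, hij.trans (he' j)⟩ (ε.symm j).2.2
    · exact absurd ⟨j, hij.symm.trans (he' i)⟩ (ε.symm i).2.2
    · have := (he' i).symm.trans (hij.trans (he' j))
      exact congrArg Sum.inr (ε.symm.injective (Subtype.ext this))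
  · have hrange : Set.range (fun i : J ⊕ Fin n => Ideal.Quotient.mk P (X (Sum.elim e e' i))) = u := by
      apply Set.Subset.antisymm
      · rintro _ ⟨i | i, rfl⟩
        · exact hsu ⟨i, rfl⟩
        · exact (he' i).symm ▸ (ε.symm i).2.1
      · intro a ha
        by_cases has : a ∈ Set.range fun j => Ideal.Quotient.mk P (X (e j))
        · obtain ⟨j, rfl⟩ := has
          exact ⟨Sum.inl j, rfl⟩
        · refine ⟨Sum.inr (ε ⟨a, ha, has⟩), (he' _).trans ?_⟩
          rw [Equiv.symm_apply_apply]
    rw [hrange]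
    exact hu

end Coordinates

/-! ### The two cases for an irreducible variety: projection not dense, projection dense -/

section Projection

open MvPolynomial

variable {K : Type*} [Field K]

theorem mk_vanishingIdeal_eq_zero_iff {σ : Type*} {V : Set (σ → K)} {p : MvPolynomial σ K} :
    Ideal.Quotient.mk (vanishingIdeal K V) p = 0 ↔ ∀ x ∈ V, eval x p = 0 := by
  rw [Ideal.Quotient.eq_zero_iff_mem, mem_vanishingIdeal_iff]
  simp [aeval_eq_eval]

theorem aeval_mk_X {σ τ : Type*} (P : Ideal (MvPolynomial σ K)) (f : τ → σ)
    (p : MvPolynomial τ K) :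
    aeval (fun j => Ideal.Quotient.mk P (X (f j))) p = Ideal.Quotient.mk P (rename f p) := by
  have h : aeval (fun j => Ideal.Quotient.mk P (X (R := K) (f j))) =
      (Ideal.Quotient.mkₐ K P).comp (rename f) := by
    ext j; simp
  rw [h]; rfl

theorem totalDegree_le_totalDegree_rename {τ υ : Type*} {f : τ → υ} (hf : Function.Injective f)
    (p : MvPolynomial τ K) : p.totalDegree ≤ (rename f p).totalDegree := by
  conv_lhs => rw [← killCompl_rename_app hf p]
  refine totalDegree_aeval_le_of_totalDegree_le_one _ (fun i => ?_) _
  split_ifs <;> simp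

/-- An algebraically dependent family contains a circuit. -/
theorem exists_circuit {A τ : Type*} [CommRing A] [IsDomain A] [Algebra K A] [Finite τ]
    {y : τ → A} (hy : ¬ AlgebraicIndependent K y) :
    ∃ (J : Set τ) (j : τ), j ∉ J ∧ AlgebraicIndependent K (fun i : J => y i) ∧
      ∃ F : MvPolynomial (Option J) K, Irreducible F ∧
        aeval (fun o : Option J => o.elim (y j) fun i => y i) F = 0 := by
  obtain ⟨J, hJ⟩ := (Set.toFinite {J : Set τ | AlgebraicIndepOn K y J}).exists_maximal
    ⟨∅, algebraicIndependent_empty_type_iff.2 (algebraMap K A).injective⟩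
  have hJind : AlgebraicIndependent K fun j : J => y j := hJ.prop
  obtain ⟨j, hj⟩ : ∃ j, j ∉ J := by
    by_contra! hall
    exact hy (hJind.comp (fun j => (⟨j, hall j⟩ : J)) fun a b hab => congrArg Subtype.val hab)
  refine ⟨J, j, hj, hJind, exists_irreducible_aeval_eq_zero fun h => ?_⟩
  have hins : AlgebraicIndepOn K y (insert j J) := by
    rw [AlgebraicIndepOn.insert_iff hj]
    rw [hJind.option_iff_transcendental] at h
    refine ⟨hJind, ?_⟩
    rwa [Set.image_eq_range]
  exact hj (hJ.le_of_ge hins (Set.subset_insert j J) (Set.mem_insert j J))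

variable {q r : ℕ} {V : Set (Fin q ⊕ Fin r → K)}

theorem eval_rename_inr (x : Fin q ⊕ Fin r → K) (p : MvPolynomial (Fin r) K) :
    eval x (rename Sum.inr p) = eval (proj x) p :=
  eval_rename _ _ _

/-- A polynomial relation among the last `r` coordinates on `V` is the same thing as a hypersurface
containing the projection. -/
theorem isZariskiDense_proj_iff [Infinite K] :
    IsZariskiDense (proj '' V) ↔
      AlgebraicIndependent K fun j : Fin r =>
        Ideal.Quotient.mk (vanishingIdeal K V) (X (Sum.inr j)) := by
  constructor
  · intro h
    rw [algebraicIndependent_iff]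
    intro p hp
    rw [aeval_mk_X, mk_vanishingIdeal_eq_zero_iff] at hp
    have huniv := h _ (isZariskiClosed_setOf_eval_eq_zero p) (by
      rintro _ ⟨x, hx, rfl⟩
      rw [Set.mem_ofPred_eq, ← eval_rename_inr]
      exact hp x hx)
    refine MvPolynomial.funext fun a => ?_
    rw [map_zero]
    exact (huniv ▸ Set.mem_univ a : a ∈ {x | eval x p = 0})
  · rintro h W ⟨I, rfl⟩ hVW
    have hI : I = ⊥ := by
      rw [eq_bot_iff]
      intro p hp
      refine (algebraicIndependent_iff.1 h) p ?_
      rw [aeval_mk_X, mk_vanishingIdeal_eq_zero_iff]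
      intro x hx
      rw [eval_rename_inr]
      simpa [aeval_eq_eval] using hVW ⟨x, hx, rfl⟩ p hp
    rw [hI, zeroLocus_bot, Set.top_eq_univ]

variable [IsAlgClosed K] [CharZero K]

/-- If the projection of `V` is not dense, it lies on a hypersurface of degree at most `deg V`. -/
theorem exists_eval_proj_eq_zero_of_not_dense (hV : IsIrreducibleClosed V)
    (hnd : ¬ IsZariskiDense (proj '' V)) :
    ∃ H : MvPolynomial (Fin r) K, H ≠ 0 ∧ (H.totalDegree : ℕ∞) ≤ irredDegree V ∧
      ∀ x ∈ V, eval (proj x) H = 0 := by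
  classical
  have : Infinite K := IsAlgClosed.instInfinite
  have := hV.isPrime
  set P := vanishingIdeal K V with hP
  rw [isZariskiDense_proj_iff] at hnd
  obtain ⟨J, j, hj, hJind, F, hF, hF0⟩ := exists_circuit hnd
  -- The degree bound asks for a full transcendence basis. The added coordinates do not occur in
  -- `F`, which stays irreducible in the larger ring.
  obtain ⟨n, e', hbasis⟩ := exists_isTranscendenceBasis_sumElim_coordinates (P := P)
    (e := fun i : J => Sum.inr (i : Fin r)) hJind
  set e : J ⊕ Fin n → Fin q ⊕ Fin r := Sum.elim (fun i : J => Sum.inr (i : Fin r)) e' with he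
  have hinl : Function.Injective (Option.map (Sum.inl : J → J ⊕ Fin n)) :=
    Option.map_injective Sum.inl_injective
  have hdeg := totalDegree_le_irredDegree hV (fun i => Pi.single (e i) 1)
    (Pi.single (Sum.inr j) 1) (by simpa only [linearForm_single] using hbasis)
    (irreducible_rename hinl hF) (by
      simp only [linearForm_single]
      rw [aeval_rename, ← hF0]
      congr 2
      funext o
      cases o <;> rfl)
  replace hdeg := le_trans (Nat.cast_le.2 (totalDegree_le_totalDegree_rename hinl F)) hdeg
  have hopt : Function.Injective fun o : Option J => o.elim j fun i => (i : Fin r) := by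
    rintro (_ | a) (_ | b) hab
    · rfl
    · exact absurd ((show j = (b : Fin r) from hab) ▸ b.2 : j ∈ J) hj
    · exact absurd ((show (a : Fin r) = j from hab) ▸ a.2 : j ∈ J) hj
    · exact congrArg some (Subtype.ext hab)
  refine ⟨rename (fun o : Option J => o.elim j fun i => (i : Fin r)) F,
    (map_ne_zero_iff _ (rename_injective _ hopt)).2 hF.ne_zero,
    le_trans (by exact_mod_cast totalDegree_rename_le _ _) hdeg, ?_⟩
  have h : aeval (fun j : Fin r => Ideal.Quotient.mk P (X (Sum.inr j)))
      (rename (fun o : Option J => o.elim j fun i => (i : Fin r)) F) = 0 := by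
    rw [aeval_rename, ← hF0]
    congr 2
    funext o
    cases o <;> rfl
  rw [aeval_mk_X, mk_vanishingIdeal_eq_zero_iff] at h
  intro x hx
  rw [← eval_rename_inr]
  exact h x hx

theorem card_le_of_not_dense (hV : IsIrreducibleClosed V) (hnd : ¬ IsZariskiDense (proj '' V))
    (S : Finset K) (M : Finset (Fin r → K))
    (hM : ∀ a ∈ M, (∀ j, a j ∈ S) ∧ a ∈ proj '' V) :
    ∃ D : ℕ, (D : ℕ∞) ≤ irredDegree V ∧ M.card * S.card ≤ D * S.card ^ r := by
  classical
  obtain ⟨H, hH0, hHdeg, hH⟩ := exists_eval_proj_eq_zero_of_not_dense hV hnd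
  refine ⟨H.totalDegree, hHdeg, ?_⟩
  have h := card_zeros_mul_card_le hH0 S M fun a ha => ⟨(hM a ha).1, by
    obtain ⟨x, hx, rfl⟩ := (hM a ha).2
    exact hH x hx⟩
  rwa [Fintype.card_fin] at h

section Integrality

variable {A ι : Type*} [CommRing A] [Algebra K A] [Algebra (MvPolynomial ι K) A]
  [IsScalarTower K (MvPolynomial ι K) A]

/-- The elements of `A` that are integral over the local ring of affine space at `b`, up to a
denominator not vanishing at `b`. -/
def integralAt (b : ι → K) : Submodule K A where
  carrier := {a | ∃ f : MvPolynomial ι K, eval b f ≠ 0 ∧ IsIntegral (MvPolynomial ι K) (f • a)}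
  zero_mem' := ⟨1, by simp, by rw [smul_zero]; exact isIntegral_zero⟩
  add_mem' := by
    rintro x y ⟨f, hf, hfx⟩ ⟨g, hg, hgy⟩
    refine ⟨f * g, by rw [map_mul]; exact mul_ne_zero hf hg, ?_⟩
    have h := (hfx.smul g).add (hgy.smul f)
    rwa [smul_smul, smul_smul, mul_comm g f, ← smul_add] at h
  smul_mem' := by
    rintro c x ⟨f, hf, hfx⟩
    refine ⟨f, hf, ?_⟩
    have h := hfx.smul (C c : MvPolynomial ι K)
    rwa [smul_smul, mul_comm, ← smul_smul, ← algebraMap_eq, algebraMap_smul] at h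

/-- The product of the denominators of the finitely many generators serves them all and is still
nonzero at `b`, so the point `b` lifts. -/
theorem exists_algHom_of_integralAt_eq_top [Algebra.FiniteType K A]
    [FaithfulSMul (MvPolynomial ι K) A] {t : Set A} (htf : t.Finite)
    (ht : Algebra.adjoin K t = ⊤) {b : ι → K} (hb : ∀ a ∈ t, a ∈ integralAt (A := A) b) :
    ∃ φ : A →ₐ[K] K, ∀ i, φ (algebraMap (MvPolynomial ι K) A (X i)) = b i := by
  classical
  have := htf.fintype
  choose f hf hfi using fun a : t => hb a a.2
  obtain ⟨φ, hφ⟩ := exists_algHom_of_isIntegral_smul (∏ a, f a) ht (fun a ha => by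
    rw [← Finset.prod_erase_mul _ _ (Finset.mem_univ (⟨a, ha⟩ : t)), mul_smul]
    exact (hfi ⟨a, ha⟩).smul _) (aeval b : MvPolynomial ι K →ₐ[K] K) (by
      rw [aeval_eq_eval]
      change eval b _ ≠ 0
      rw [map_prod]
      exact Finset.prod_ne_zero_iff.2 fun a _ => hf a)
  exact ⟨φ, fun i => by rw [hφ, aeval_X]⟩

end Integrality

/-- For a dominant projection, the points of a grid over which the fibre is empty. -/
theorem card_le_of_dense (hV : IsIrreducibleClosed V) (hd : IsZariskiDense (proj '' V))
    (S : Finset K) (M : Finset (Fin r → K))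
    (hM : ∀ a ∈ M, (∀ j, a j ∈ S) ∧ a ∉ proj '' V) :
    ∃ D : ℕ, (D : ℕ∞) ≤ irredDegree V ∧ M.card * S.card ≤ D * S.card ^ r := by
  classical
  have : Infinite K := IsAlgClosed.instInfinite
  rcases S.eq_empty_or_nonempty with rfl | hS
  · exact ⟨0, by simp, by simp⟩
  have := hV.isPrime
  set P := vanishingIdeal K V with hP
  rw [isZariskiDense_proj_iff] at hd
  obtain ⟨n, e', hbasis⟩ := exists_isTranscendenceBasis_sumElim_coordinates (P := P)
    (e := fun j : Fin r => Sum.inr j) hd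
  set e : Fin r ⊕ Fin n → Fin q ⊕ Fin r := Sum.elim (fun j : Fin r => Sum.inr j) e' with he
  let w : Fin r ⊕ Fin n → MvPolynomial (Fin q ⊕ Fin r) K ⧸ P := fun i => Ideal.Quotient.mk P (X (e i))
  let _ := algebraOfFamily (K := K) w
  have := isScalarTower_algebraOfFamily (K := K) w
  have := faithfulSMul_algebraOfFamily hbasis.1
  let lin : (Fin q ⊕ Fin r → K) →ₗ[K] MvPolynomial (Fin q ⊕ Fin r) K ⧸ P :=
    (Ideal.Quotient.mkₐ K P).toLinearMap.comp linearForm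
  -- `L b` collects the linear forms integral near `b`. If it were everything, all coordinates would
  -- be integral near `b` and `b` would lift to a point of `V`.
  let L : (Fin r ⊕ Fin n → K) → Subspace K (Fin q ⊕ Fin r → K) := fun b =>
    (integralAt b).comap lin
  -- No point of `V` lies over `a`, so none lies over `(a, c)` for any `c ∈ S^n`.
  let M' : Finset (Fin r ⊕ Fin n → K) :=
    (M ×ˢ Fintype.piFinset fun _ : Fin n => S).image fun ac => Sum.elim ac.1 ac.2
  have hM' : ∀ b ∈ M', (∀ i, b i ∈ S) ∧ L b ≠ ⊤ := by
    intro b hb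
    obtain ⟨⟨a, c⟩, hac, rfl⟩ := Finset.mem_image.1 hb
    obtain ⟨ha, hc⟩ := Finset.mem_product.1 hac
    refine ⟨fun i => ?_, fun htop => (hM a ha).2 ?_⟩
    · cases i with
      | inl j => exact (hM a ha).1 j
      | inr j => exact Fintype.mem_piFinset.1 hc j
    · obtain ⟨φ, hφ⟩ := exists_algHom_of_integralAt_eq_top (Set.finite_range _)
        (adjoin_range_mk_X P) (b := Sum.elim a c) (by
          rintro _ ⟨i, rfl⟩
          have : (Pi.single i (1 : K) : Fin q ⊕ Fin r → K) ∈ L (Sum.elim a c) :=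
            htop ▸ Submodule.mem_top
          rw [Submodule.mem_comap] at this
          simpa [lin, linearForm_single] using this)
      obtain ⟨x, hxV, hx⟩ := exists_point_of_algHom hV.1 φ
      refine ⟨x, hxV, funext fun j => ?_⟩
      have h := hφ (Sum.inl j)
      have hX : algebraMap (MvPolynomial (Fin r ⊕ Fin n) K) (MvPolynomial (Fin q ⊕ Fin r) K ⧸ P)
          (X (Sum.inl j)) = Ideal.Quotient.mk P (X (Sum.inr j)) := aeval_X w (Sum.inl j)
      rw [hX] at h
      exact ((hx _).trans (eval_X (Sum.inr j))).symm.trans h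
  -- A vector space over an infinite field is not a finite union of proper subspaces.
  obtain ⟨v, hv⟩ : ∃ v, ∀ b ∈ M', v ∉ L b := by
    have hne := Subspace.biUnion_ne_univ_of_top_notMem (s := M'.image L) (by
      intro h
      obtain ⟨b, hb, hbt⟩ := Finset.mem_image.1 h
      exact (hM' b hb).2 hbt)
    obtain ⟨v, hv⟩ := (Set.ne_univ_iff_exists_notMem _).1 hne
    exact ⟨v, fun b hb hvb => hv (Set.mem_biUnion (Finset.mem_image_of_mem L hb) hvb)⟩
  obtain ⟨F, hF, hF0⟩ := exists_irreducible_aeval_eq_zero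
    (v := fun o : Option (Fin r ⊕ Fin n) => o.elim (lin v) w) (by
      intro h
      rw [AlgebraicIndependent.option_iff_transcendental hbasis.1] at h
      exact h (hbasis.isAlgebraic.isAlgebraic _))
  have hdeg := totalDegree_le_irredDegree hV (fun i => Pi.single (e i) 1) v
    (by simpa only [linearForm_single] using hbasis) hF
    (by simp only [linearForm_single]; exact hF0)
  refine ⟨F.totalDegree, hdeg, ?_⟩
  set p := optionEquivLeft K (Fin r ⊕ Fin n) F with hp
  have hp0 : p.leadingCoeff ≠ 0 := by
    rw [Polynomial.leadingCoeff_ne_zero, hp]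
    exact (map_ne_zero_iff _ (optionEquivLeft K _).injective).2 hF.ne_zero
  have hpint : IsIntegral (MvPolynomial (Fin r ⊕ Fin n) K) (p.leadingCoeff • lin v) :=
    isIntegral_leadingCoeff_smul p _ (by rw [hp, aeval_elim_eq_aeval_optionEquivLeft, hF0])
  -- If the leading coefficient were nonzero at `b`, it would be a denominator witnessing `v ∈ L b`.
  have hSZ := card_zeros_mul_card_le hp0 S M' fun b hb => ⟨(hM' b hb).1, by
    by_contra hne
    exact hv b hb ⟨_, hne, hpint⟩⟩
  have hcard : M'.card = M.card * S.card ^ n := by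
    rw [Finset.card_image_of_injective, Finset.card_product, Fintype.card_piFinset]
    · simp
    · rintro ⟨a, c⟩ ⟨a', c'⟩ h
      exact Prod.ext (funext fun j => congrFun h (Sum.inl j)) (funext fun j => congrFun h (Sum.inr j))
  have hle : p.leadingCoeff.totalDegree ≤ F.totalDegree := totalDegree_coeff_optionEquivLeft_le _ _ F _
  rw [hcard, Fintype.card_sum, Fintype.card_fin, Fintype.card_fin, pow_add] at hSZ
  have hpos : 0 < S.card ^ n := pow_pos hS.card_pos n
  refine Nat.le_of_mul_le_mul_right (c := S.card ^ n) ?_ hpos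
  calc M.card * S.card * S.card ^ n = M.card * S.card ^ n * S.card := by ring
    _ ≤ _ := hSZ
    _ ≤ F.totalDegree * (S.card ^ r * S.card ^ n) := Nat.mul_le_mul_right _ hle
    _ = _ := by ring

end Projection

/-! ### Irreducible components and minimal primes -/

section Components

open MvPolynomial

variable {K σ : Type*} [Field K]

theorem mem_components_iff {X Z : Set (σ → K)} :
    Z ∈ components X ↔ Maximal (fun V => IsIrreducibleClosed V ∧ V ⊆ X) Z := Iff.rfl

theorem isIrreducibleClosed_of_mem_components {X Z : Set (σ → K)} (hZ : Z ∈ components X) :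
    IsIrreducibleClosed Z := (mem_components_iff.1 hZ).prop.1

theorem subset_of_mem_components {X Z : Set (σ → K)} (hZ : Z ∈ components X) : Z ⊆ X :=
  (mem_components_iff.1 hZ).prop.2

theorem exists_isZariskiClosed_ne_univ_forall_subset [IsAlgClosed K] {ι : Type*} (s : Finset ι)
    (W : ι → Set (σ → K)) (hW : ∀ i ∈ s, IsZariskiClosed (W i)) (hne : ∀ i ∈ s, W i ≠ Set.univ) :
    ∃ U, IsZariskiClosed U ∧ U ≠ Set.univ ∧ ∀ i ∈ s, W i ⊆ U := by
  have : Infinite K := IsAlgClosed.instInfinite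
  have h : ∀ i : s, ∃ f : MvPolynomial σ K, f ≠ 0 ∧ ∀ x ∈ W i, eval x f = 0 := by
    rintro ⟨i, hi⟩
    obtain ⟨I, hI⟩ := hW i hi
    obtain ⟨x, hx⟩ := (Set.ne_univ_iff_exists_notMem _).1 (hne i hi)
    simp only [hI, mem_zeroLocus_iff, not_forall] at hx
    obtain ⟨f, hf, hfx⟩ := hx
    refine ⟨f, fun h0 => hfx (by rw [h0, map_zero]), fun y hy => ?_⟩
    rw [hI] at hy
    simpa [aeval_eq_eval] using hy f hf
  choose f hf0 hf using h
  have hprod : ∏ i, f i ≠ 0 := Finset.prod_ne_zero_iff.2 fun i _ => hf0 i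
  refine ⟨_, isZariskiClosed_setOf_eval_eq_zero (∏ i, f i), fun huniv => hprod ?_,
    fun i hi x hx => ?_⟩
  · refine MvPolynomial.funext fun x => ?_
    rw [map_zero]
    exact (huniv ▸ Set.mem_univ x : x ∈ {x | eval x (∏ i, f i) = 0})
  · rw [Set.mem_ofPred_eq, map_prod]
    exact Finset.prod_eq_zero (Finset.mem_univ ⟨i, hi⟩) (hf _ x hx)

variable [IsAlgClosed K] [Finite σ]

theorem mem_components_of_mem_minimalPrimes {X : Set (σ → K)} (hX : IsZariskiClosed X)
    {p : Ideal (MvPolynomial σ K)} (hp : p ∈ (vanishingIdeal K X).minimalPrimes) :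
    zeroLocus K p ∈ components X := by
  have hpp : p.IsPrime := hp.1.1
  refine ⟨⟨isIrreducibleClosed_zeroLocus p, ?_⟩, fun V hV hle => ?_⟩
  · rw [← hX.zeroLocus_vanishingIdeal]
    exact zeroLocus_anti_mono hp.1.2
  · have h1 : vanishingIdeal K V ≤ p := by
      rw [← IsPrime.vanishingIdeal_zeroLocus (K := K) p]
      exact vanishingIdeal_anti_mono hle
    have h2 := hp.2 ⟨hV.1.isPrime, vanishingIdeal_anti_mono hV.2⟩ h1
    rw [← hV.1.1.zeroLocus_vanishingIdeal]
    exact zeroLocus_anti_mono h2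

theorem finite_components {X : Set (σ → K)} (hX : IsZariskiClosed X) : (components X).Finite := by
  refine ((Ideal.finite_minimalPrimes_of_isNoetherianRing _ (vanishingIdeal K X)).image
    (zeroLocus (k := K) K)).subset fun Z hZ => ?_
  have := (isIrreducibleClosed_of_mem_components hZ).isPrime
  obtain ⟨p, hp, hle⟩ := Ideal.exists_minimalPrimes_le
    (vanishingIdeal_anti_mono (k := K) (subset_of_mem_components hZ))
  have hp' := mem_components_iff.1 (mem_components_of_mem_minimalPrimes hX hp)
  refine ⟨p, hp, ((mem_components_iff.1 hZ).eq_of_le hp'.prop ?_).symm⟩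
  rw [← (isIrreducibleClosed_of_mem_components hZ).1.zeroLocus_vanishingIdeal]
  exact zeroLocus_anti_mono hle

theorem exists_mem_components_of_mem {X : Set (σ → K)} (hX : IsZariskiClosed X) {x : σ → K}
    (hx : x ∈ X) : ∃ Z ∈ components X, x ∈ Z := by
  have hle : vanishingIdeal K X ≤ vanishingIdeal K {x} :=
    vanishingIdeal_anti_mono (Set.singleton_subset_iff.2 hx)
  obtain ⟨p, hp, hpx⟩ := Ideal.exists_minimalPrimes_le hle
  exact ⟨_, mem_components_of_mem_minimalPrimes hX hp, fun f hf => hpx hf x rfl⟩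

end Components

/-! ### Counting bad points on an arbitrary closed set -/

section Count

open MvPolynomial

variable {K : Type*} [Field K]

/-- Affine 0-space is a single point, so no point is bad when `r = 0`. This settles the corner `S =
∅`, `r = 0`, where the main estimate says nothing. -/
theorem isZariskiDense_iff_mem {r : ℕ} (hr : r = 0) (A : Set (Fin r → K)) (a : Fin r → K) :
    IsZariskiDense A ↔ a ∈ A := by
  subst hr
  constructor
  · intro h
    have hne : A.Nonempty := by
      by_contra hA
      have hempty := h ∅ ⟨⊤, by simp⟩ (Set.not_nonempty_iff_eq_empty.1 hA).subset
      exact (hempty ▸ Set.mem_univ a : a ∈ (∅ : Set (Fin 0 → K)))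
    obtain ⟨b, hb⟩ := hne
    rwa [Subsingleton.elim a b]
  · intro ha W _ hAW
    exact Set.eq_univ_of_forall fun b => Subsingleton.elim a b ▸ hAW ha

variable [IsAlgClosed K] {q r : ℕ}

theorem exists_component_dense {X : Set (Fin q ⊕ Fin r → K)} (hX : IsZariskiClosed X)
    (hd : IsZariskiDense (proj '' X)) : ∃ Z ∈ components X, IsZariskiDense (proj '' Z) := by
  by_contra! hcon
  have hfin := finite_components hX
  have hW : ∀ Z : Set (Fin q ⊕ Fin r → K), ∃ W, Z ∈ components X →
      IsZariskiClosed W ∧ proj '' Z ⊆ W ∧ W ≠ Set.univ := by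
    intro Z
    by_cases hZ : Z ∈ components X
    · have := hcon Z hZ
      simp only [IsZariskiDense, not_forall] at this
      obtain ⟨W, hW, hsub, hne⟩ := this
      exact ⟨W, fun _ => ⟨hW, hsub, hne⟩⟩
    · exact ⟨∅, fun h => absurd h hZ⟩
  choose W hW using hW
  obtain ⟨U, hU, hUne, hWU⟩ := exists_isZariskiClosed_ne_univ_forall_subset hfin.toFinset W
    (fun Z hZ => (hW Z (hfin.mem_toFinset.1 hZ)).1)
    (fun Z hZ => (hW Z (hfin.mem_toFinset.1 hZ)).2.2)
  refine hUne (hd U hU ?_)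
  rintro _ ⟨x, hx, rfl⟩
  obtain ⟨Z, hZ, hxZ⟩ := exists_mem_components_of_mem hX hx
  exact hWU Z (hfin.mem_toFinset.2 hZ) ((hW Z hZ).2.1 ⟨x, hxZ, rfl⟩)

/-- If the projection of `X` is dense, so is that of some component `Z`; bad points miss the image
of `X`, hence that of `Z`, and `deg Z ≤ deg X`. Otherwise no component is dominant, each bad point
lies in the image of some component, and the bounds are summed. -/
theorem card_mul_card_le_degree [CharZero K] {X : Set (Fin q ⊕ Fin r → K)} (hX : IsZariskiClosed X)
    (S : Finset K) (M : Finset (Fin r → K))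
    (hM : ∀ a ∈ M, (∀ j, a j ∈ S) ∧ ¬ (IsZariskiDense (proj '' X) ↔ a ∈ proj '' X)) :
    ((M.card * S.card : ℕ) : ℕ∞) ≤ degree X * (S.card ^ r : ℕ) := by
  classical
  have hfin := finite_components hX
  rw [degree, finsum_mem_eq_finite_toFinset_sum _ hfin]
  by_cases hd : IsZariskiDense (proj '' X)
  · obtain ⟨Z, hZ, hZd⟩ := exists_component_dense hX hd
    obtain ⟨D, hD, h⟩ := card_le_of_dense (isIrreducibleClosed_of_mem_components hZ) hZd S M fun a ha => ⟨(hM a ha).1, fun h =>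
      (hM a ha).2 (iff_of_true hd (Set.image_mono (subset_of_mem_components hZ) h))⟩
    calc ((M.card * S.card : ℕ) : ℕ∞) ≤ (D * S.card ^ r : ℕ) := Nat.cast_le.2 h
      _ = D * (S.card ^ r : ℕ) := Nat.cast_mul _ _
      _ ≤ _ := by
        gcongr
        exact hD.trans (Finset.single_le_sum (f := fun Z => irredDegree Z)
          (fun _ _ => zero_le) (hfin.mem_toFinset.2 hZ))
  · have hnd : ∀ Z ∈ components X, ¬ IsZariskiDense (proj '' Z) := fun Z hZ hZd =>
      hd fun W hW hXW => hZd W hW ((Set.image_mono (subset_of_mem_components hZ)).trans hXW)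
    have hcard : M.card ≤ ∑ Z ∈ hfin.toFinset, (M.filter fun a => a ∈ proj '' Z).card := by
      refine (Finset.card_le_card fun a ha => ?_).trans Finset.card_biUnion_le
      have : a ∈ proj '' X := by
        by_contra h
        exact (hM a ha).2 (iff_of_false hd h)
      obtain ⟨x, hx, rfl⟩ := this
      obtain ⟨Z, hZ, hxZ⟩ := exists_mem_components_of_mem hX hx
      exact Finset.mem_biUnion.2 ⟨Z, hfin.mem_toFinset.2 hZ,
        Finset.mem_filter.2 ⟨ha, x, hxZ, rfl⟩⟩
    calc ((M.card * S.card : ℕ) : ℕ∞)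
        ≤ ((∑ Z ∈ hfin.toFinset, (M.filter fun a => a ∈ proj '' Z).card * S.card : ℕ) : ℕ∞) := by
          rw [← Finset.sum_mul]
          exact Nat.cast_le.2 (Nat.mul_le_mul_right _ hcard)
      _ ≤ ∑ Z ∈ hfin.toFinset, irredDegree Z * (S.card ^ r : ℕ) := by
          rw [Nat.cast_sum]
          refine Finset.sum_le_sum fun Z hZ => ?_
          have hZ' := hfin.mem_toFinset.1 hZ
          obtain ⟨D, hD, h⟩ := card_le_of_not_dense (isIrreducibleClosed_of_mem_components hZ') (hnd Z hZ') S
            (M.filter fun a => a ∈ proj '' Z) fun a ha =>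
              ⟨(hM a (Finset.mem_filter.1 ha).1).1, (Finset.mem_filter.1 ha).2⟩
          calc _ ≤ ((D * S.card ^ r : ℕ) : ℕ∞) := Nat.cast_le.2 h
            _ = D * (S.card ^ r : ℕ) := Nat.cast_mul _ _
            _ ≤ _ := by gcongr
      _ = _ := by rw [Finset.sum_mul]

end Count

end AffVar

/-! ### The theorem over `k`, by passing to the image of the grid in `K` -/

theorem mainTheorem7 {k K : Type*} [Field k] [CharZero k] [Field K] [Algebra k K] [IsAlgClosed K]
    (q r : ℕ) (X : Set (Fin q ⊕ Fin r → K))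
    (hX : ∃ I : Ideal (MvPolynomial (Fin q ⊕ Fin r) k), X = MvPolynomial.zeroLocus K I)
    (S : Finset k) :
    (1 - ((AffVar.degree X : ℕ∞) : ℝ≥0∞) / (S.card : ℝ≥0∞)) * (S.card : ℝ≥0∞) ^ r ≤
      (({a : Fin r → k | (∀ j, a j ∈ S) ∧
        (AffVar.IsZariskiDense (AffVar.proj '' X) ↔
          {x ∈ X | AffVar.proj x = fun j => algebraMap k K (a j)}.Nonempty)}.ncard : ℕ) : ℝ≥0∞) := by
  classical
  have : CharZero K := charZero_of_injective_algebraMap (algebraMap k K).injective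
  have hXK : AffVar.IsZariskiClosed X := by
    obtain ⟨I, rfl⟩ := hX
    refine ⟨I.map (MvPolynomial.map (algebraMap k K)), Set.ext fun x => ?_⟩
    rw [Ideal.map, MvPolynomial.zeroLocus_span]
    simp [MvPolynomial.aeval_def]
  let ψ : (Fin r → k) → (Fin r → K) := fun a j => algebraMap k K (a j)
  have hψ : Function.Injective ψ := fun a b hab =>
    funext fun j => (algebraMap k K).injective (congrFun hab j)
  let G : Finset (Fin r → k) := Fintype.piFinset fun _ => S
  let good : (Fin r → k) → Prop := fun a => AffVar.IsZariskiDense (AffVar.proj '' X) ↔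
    {x ∈ X | AffVar.proj x = ψ a}.Nonempty
  have hset : {a : Fin r → k | (∀ j, a j ∈ S) ∧ good a} = (G.filter good : Set (Fin r → k)) := by
    ext a
    simp [G, Fintype.mem_piFinset]
  change _ ≤ (({a : Fin r → k | (∀ j, a j ∈ S) ∧ good a}.ncard : ℕ) : ℝ≥0∞)
  rw [hset, Set.ncard_coe_finset]
  have hsum : (G.filter good).card + (G.filter fun a => ¬ good a).card = S.card ^ r := by
    rw [Finset.card_filter_add_card_filter_not]
    simp [G]
  have hbad := AffVar.card_mul_card_le_degree hXK (S.image (algebraMap k K))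
    ((G.filter fun a => ¬ good a).image ψ) (by
      intro b hb
      obtain ⟨a, ha, rfl⟩ := Finset.mem_image.1 hb
      obtain ⟨haG, hag⟩ := Finset.mem_filter.1 ha
      refine ⟨fun j => Finset.mem_image_of_mem _ (Fintype.mem_piFinset.1 haG j), ?_⟩
      exact hag)
  rw [Finset.card_image_of_injective _ hψ,
    Finset.card_image_of_injective _ (algebraMap k K).injective] at hbad
  have hzero : r = 0 → (G.filter fun a => ¬ good a).card = 0 := by
    intro hr
    rw [Finset.card_eq_zero, Finset.filter_eq_empty_iff]
    exact fun a _ hag => hag (AffVar.isZariskiDense_iff_mem hr _ (ψ a))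
  generalize AffVar.degree X = D at hbad ⊢
  generalize (G.filter good).card = A at hsum ⊢
  generalize (G.filter fun a => ¬ good a).card = B at hsum hbad hzero
  generalize S.card = s at hsum hbad ⊢
  have hbad' : (B : ℝ≥0∞) * s ≤ (D : ℝ≥0∞) * (s : ℝ≥0∞) ^ r := by
    have := ENat.toENNReal_mono hbad
    simpa using this
  have hsum' : (A : ℝ≥0∞) + B = (s : ℝ≥0∞) ^ r := by exact_mod_cast hsum
  have hB : (B : ℝ≥0∞) ≤ D / s * (s : ℝ≥0∞) ^ r := by
    -- For `s = 0` the quotient `D / s` is 0 or `∞` according to whether `D` vanishes, so `B = 0` is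
    -- proved directly.
    rcases Nat.eq_zero_or_pos s with rfl | hs
    · rcases Nat.eq_zero_or_pos r with hr | hr
      · simp [hzero hr]
      · have : A + B = 0 := by rw [hsum, zero_pow hr.ne']
        have hB0 : B = 0 := by omega
        simp [hB0]
    · rw [← ENNReal.mul_div_right_comm, ENNReal.le_div_iff_mul_le (by simp [hs.ne']) (by simp)]
      exact hbad'
  rw [ENNReal.sub_mul fun _ _ => by finiteness, one_mul, tsub_le_iff_right, ← hsum']
  rw [← hsum'] at hB
  gcongr
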